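/- Let $G$ be an infinite group with identity $e$, and let $S\subseteq G\setminus\{e\}$ be a finite symmetric set generating $G$ as a semigroup. Let each $s\in S$ have a length $l(s)=l(s^{-1})>0$, and let $d(x,y)=\min\{\sum_{i=1}^n l(s_i) : n\ge 0,\ s_i\in S,\ y=xs_1\cdots s_n\}$ be the induced metric on $G$. Let $\mathcal L=\mathbb Z_2\wr G$ be the lamplighter group: its elements are the pairs $(\eta,x)$ with $x\in G$ and $\eta:G\to\mathbb Z_2=\mathbb Z/2\mathbb Z$ of finite support, with product $(\eta_1,x)(\eta_2,y)=(\eta_1\oplus x\eta_2,\,xy)$, where $(x\eta)(w)=\eta(x^{-1}w)$. Fix $c_{\mathcal L}\ge 0$. Equip $\mathcal L$ with the generators $(\mathbf 0,s)$, $s\in S$, of length $l(s)$, and $(\mathbb 1_e,e)$ of length $c_{\mathcal L}$, where $\mathbf 0$ is the zero configuration and $\mathbb 1_e$ is the configuration with only the lamp at $e$ on. Let $\ell(\eta,x)$ denote the minimal total length of a word in these generators representing $(\eta,x)$. Let $\mu$ be a probability measure on $\mathcal L$ such that 1. the support of $\mu$ generates $\mathcal L$ as a semigroup (that is, the random walk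 is irreducible); 2. there is $R\ge 0$ such that $\mu(\eta,x)>0$ implies $d(e,y)\le R$ for all $y\in\mathrm{supp}(\eta)$; 3. $\sum_{(\eta,x)\in\mathcal L} d(e,x)\,\mu(\eta,x)<\infty$. Let $\mathbf i_1,\mathbf i_2,\dots$ be i.i.d. $\mathcal L$-valued random variables with law $\mu$, and set $Z_0=(\mathbf 0,e)$ and $Z_n=Z_{n-1}\mathbf i_n=(\eta_n,X_n)$ for $n\ge 1$. Assume that the projection $(X_n)_{n\ge 0}$ onto $G$ is transient, i.e. $\mathbb P[\exists n\ge 1: X_n=e]<1$. Then there are real constants $\ell_0,\ell,\ell_{\mathrm{supp}}$ such that, almost surely, $$\ell_0=\lim_{n\to\infty}\frac{d(e,X_n)}{n},\qquad \ell=\lim_{n\to\infty}\frac{\ell(Z_n)}{n},\qquad \ell_{\mathrm{supp}}=\lim_{n\to\infty}\frac{|\mathrm{supp}(\eta_n)|}{n},$$ and $$\ell_{\mathrm{supp}}>0.$$ Moreover, if $c_{\mathcal L}>0$, then $\ell>\ell_0$. -/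

import Mathlib

open MeasureTheory ProbabilityTheory Filter Topology

/-- The lamplighter group `ℤ₂ ≀ G` over `G`: pairs `(η, x)` of a finitely supported lamp
configuration `η : G → ℤ/2ℤ` and a position `x ∈ G` of the lamplighter. -/
@[ext]
structure Lamplighter (G : Type*) where
  lamps : G →₀ ZMod 2
  pos : G

namespace Lamplighter

variable {G : Type*} [Group G]

/-- The translated configuration `x η`, given by `(x η)(w) = η (x⁻¹ w)`. -/
noncomputable def translate (x : G) (η : G →₀ ZMod 2) : G →₀ ZMod 2 :=
  Finsupp.equivMapDomain (Equiv.mulLeft x) η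

@[simp]
theorem translate_apply (x : G) (η : G →₀ ZMod 2) (w : G) :
    translate x η w = η (x⁻¹ * w) := rfl

noncomputable instance : One (Lamplighter G) := ⟨⟨0, 1⟩⟩

/-- `(η₁, x) (η₂, y) = (η₁ ⊕ x η₂, x y)`. -/
noncomputable instance : Mul (Lamplighter G) :=
  ⟨fun g h => ⟨g.lamps + translate g.pos h.lamps, g.pos * h.pos⟩⟩

noncomputable instance : Inv (Lamplighter G) :=
  ⟨fun g => ⟨-translate g.pos⁻¹ g.lamps, g.pos⁻¹⟩⟩

@[simp] theorem one_lamps : (1 : Lamplighter G).lamps = 0 := rfl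
@[simp] theorem one_pos : (1 : Lamplighter G).pos = 1 := rfl
@[simp] theorem mul_lamps (g h : Lamplighter G) :
    (g * h).lamps = g.lamps + translate g.pos h.lamps := rfl
@[simp] theorem mul_pos (g h : Lamplighter G) : (g * h).pos = g.pos * h.pos := rfl
@[simp] theorem inv_lamps (g : Lamplighter G) :
    g⁻¹.lamps = -translate g.pos⁻¹ g.lamps := rfl
@[simp] theorem inv_pos (g : Lamplighter G) : g⁻¹.pos = g.pos⁻¹ := rfl

noncomputable instance : Group (Lamplighter G) :=
  Group.ofLeftAxioms
    (fun a b c => by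
      ext w
      · simp [mul_assoc, add_assoc]
      · simp [mul_assoc])
    (fun a => by
      ext w
      · simp
      · simp)
    (fun a => by
      ext w
      · simp
      · simp)

/-- The lamplighter group carries the discrete σ-algebra. -/
instance : MeasurableSpace (Lamplighter G) := ⊤

/-- The generator `(𝟙_e, e)`, which switches the lamp at the current position. -/
noncomputable def switch : Lamplighter G := ⟨Finsupp.single 1 1, 1⟩

/-- The generator `(𝟎, s)`, which moves the lamplighter by `s`. -/
noncomputable def step (s : G) : Lamplighter G := ⟨0, s⟩

/-- The generating set `S_L = {(𝟙_e, e)} ∪ {(𝟎, s) | s ∈ S}`. -/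
def generators (S : Set G) : Set (Lamplighter G) := insert switch (step '' S)

open Classical in
/-- Lengths of the elements of `S_L`: `(𝟙_e, e)` has length `c` and `(𝟎, s)` has length `l s`
(the values outside `S_L` play no role). -/
noncomputable def genLength (l : G → ℝ) (c : ℝ) (g : Lamplighter G) : ℝ :=
  if g = switch then c else l g.pos

end Lamplighter

/-- The (pseudo-)distance on a group `Γ` given by lengths `l s` of the elements `s` of a
generating set `S`: the least value of `l s₁ + ⋯ + l sₙ` over all ways
`y = x s₁ ⋯ sₙ` (with `n ≥ 0` and `sᵢ ∈ S`) of reaching `y` from `x`. -/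
noncomputable def wordDist {Γ : Type*} [Group Γ] (S : Set Γ) (l : Γ → ℝ) (x y : Γ) : ℝ :=
  sInf {r : ℝ | ∃ w : List Γ, (∀ s ∈ w, s ∈ S) ∧ y = x * w.prod ∧ r = (w.map l).sum}

/-- The length function `ℓ(η, x)`: the distance in the lamplighter group from `(𝟎, e)` to `(η, x)`
with respect to the generators `S_L`. -/
noncomputable def Lamplighter.length {G : Type*} [Group G] (S : Set G) (l : G → ℝ) (c : ℝ)
    (g : Lamplighter G) : ℝ :=
  wordDist (Lamplighter.generators S) (Lamplighter.genLength l c) 1 g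

/-- The random walk with increments `i 0, i 1, …`, started at the identity:
`Z 0 = 1` and `Z (n + 1) = Z n * i n`. -/
def randomWalk {Ω Γ : Type*} [Group Γ] (i : ℕ → Ω → Γ) : ℕ → Ω → Γ
  | 0, _ => 1
  | n + 1, ω => randomWalk i n ω * i n ω

/-- A random walk `X` on a group, started at the identity, is transient if the probability that it
ever returns to the identity is strictly less than one. -/
def TransientWalk {Ω Γ : Type*} [MeasurableSpace Ω] [Group Γ] (P : Measure Ω)
    (X : ℕ → Ω → Γ) : Prop :=
  P {ω | ∃ n : ℕ, 1 ≤ n ∧ X n ω = 1} < 1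

/-!
The distance `d(1, X n)`, the length `ℓ(Z n)` and the number of lit lamps are subadditive functions
of the increments of the walk `Z`, and they have finite mean, since an increment switches lamps in
a fixed finite ball only. Their linear growth rates therefore exist by a subadditive ergodic
theorem for random walks on countable groups, `exists_tendsto_apply_pathProd_div`. Its upper half
is the strong law of large numbers for blocks of increments. For the lower half, the paths that dip
infinitely below a line of slope `b` form a shift-invariant event; if it had probability one,
cutting almost every path at such dips would bound the mean speed by `b`
(`apply_pathProd_le_badCost`, `pathLaw_dipSet_eq_zero`). The theorem also identifies the almost sure
speed with the limit of the mean speeds.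

Hence, for the positivity of the speed at which lamps are lit, it suffices to bound the expected
number of lit lamps below. A transient walk leaves every finite set for good
(`ae_eventually_notMem_finite`), so the lamp at the identity settles in some state, with the walk
away from the identity, after some time `M` with positive probability. A walk that first switches
that lamp, which has positive probability by irreducibility, lets it settle in the other state
(`exists_settledSet_ne_zero`). At each time `k` the lamp at the current place is thus lit from time
`k + M` on, and the place is not revisited from then on, with probability at least some `p > 0`
that does not depend on `k`, whatever the past (`le_pathLaw_litSet`). Applied at multiples of `M`
this yields distinct lit lamps, whose number has mean at least `p * ⌊n / M⌋`.

Finally, a word for `(η, x)` contains a word for `x` and at least one switch per lit lamp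
(`Lamplighter.wordDist_add_le_length`), so that `ℓ ≥ ℓ₀ + c * ℓsupp`.
-/

/-! ### Products along sequences of increments -/

section PathProd

variable {Γ : Type*} [Group Γ]

/-- The product `x 0 * x 1 * ⋯ * x (n - 1)` of the first `n` terms of a sequence `x`: the position
at time `n` of the walk with increments `x`. -/
def pathProd (x : ℕ → Γ) : ℕ → Γ
  | 0 => 1
  | n + 1 => pathProd x n * x n

/-- The sequence `x` with its first `n` terms deleted. -/
def shift {α : Type*} (n : ℕ) (x : ℕ → α) : ℕ → α := fun k => x (n + k)

@[simp] theorem shift_apply {α : Type*} (n : ℕ) (x : ℕ → α) (k : ℕ) :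
    shift n x k = x (n + k) := rfl

@[simp] theorem shift_zero {α : Type*} (x : ℕ → α) : shift 0 x = x := by
  ext k; simp

theorem shift_shift {α : Type*} (m n : ℕ) (x : ℕ → α) :
    shift m (shift n x) = shift (n + m) x := by
  ext k; simp [add_assoc]

@[simp] theorem pathProd_zero (x : ℕ → Γ) : pathProd x 0 = 1 := rfl

theorem pathProd_succ (x : ℕ → Γ) (n : ℕ) : pathProd x (n + 1) = pathProd x n * x n := rfl

@[simp] theorem pathProd_one (x : ℕ → Γ) : pathProd x 1 = x 0 := by simp [pathProd_succ]

theorem pathProd_add (x : ℕ → Γ) (m n : ℕ) :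
    pathProd x (m + n) = pathProd x m * pathProd (shift m x) n := by
  induction n with
  | zero => simp
  | succ n ih => rw [← add_assoc, pathProd_succ, ih, pathProd_succ, shift_apply, mul_assoc]

theorem pathProd_congr {x y : ℕ → Γ} {n : ℕ} (h : ∀ k < n, x k = y k) :
    pathProd x n = pathProd y n := by
  induction n with
  | zero => rfl
  | succ n ih =>
    rw [pathProd_succ, pathProd_succ, ih fun k hk => h k (by omega), h n (by omega)]

theorem randomWalk_eq_pathProd {Ω : Type*} (i : ℕ → Ω → Γ) (n : ℕ) (ω : Ω) :
    randomWalk i n ω = pathProd (fun k => i k ω) n := by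
  induction n with
  | zero => rfl
  | succ n ih => rw [pathProd_succ, ← ih]; rfl

theorem apply_pathProd_le_sum {f : Γ → ℝ} (h1 : f 1 = 0) (hsub : ∀ g h, f (g * h) ≤ f g + f h)
    (x : ℕ → Γ) (n : ℕ) : f (pathProd x n) ≤ ∑ t ∈ Finset.range n, f (x t) := by
  induction n with
  | zero => simp [h1]
  | succ n ih => rw [Finset.sum_range_succ, pathProd_succ]; linarith [hsub (pathProd x n) (x n)]

end PathProd

/-! ### Independent increments -/

section Independence

variable {Γ : Type*} [MeasurableSpace Γ]

/-- The law of a sequence of i.i.d. increments with common law `m`. -/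
noncomputable abbrev pathLaw (m : Measure Γ) [IsProbabilityMeasure m] : Measure (ℕ → Γ) :=
  Measure.infinitePi fun _ => m

theorem measurable_shift {α : Type*} [MeasurableSpace α] (n : ℕ) :
    Measurable (shift n : (ℕ → α) → ℕ → α) :=
  measurable_pi_iff.2 fun k => measurable_pi_apply (n + k)

variable (m : Measure Γ) [IsProbabilityMeasure m]

theorem measurePreserving_shift (n : ℕ) :
    MeasurePreserving (shift n) (pathLaw m) (pathLaw m) where
  measurable := measurable_shift n
  map_eq := by
    have h := (iIndepFun_infinitePi (P := fun _ : ℕ => m) (X := fun _ x => x)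
      (fun _ => measurable_id)).precomp (g := fun k => n + k) (add_right_injective n)
    have h2 := h.map_fun_eq_infinitePi_map (fun k => measurable_pi_apply (n + k))
    refine h2.trans ?_
    congr 1
    ext1 k
    exact Measure.infinitePi_map_eval _ (n + k)

theorem comap_shift_le {α : Type*} [mα : MeasurableSpace α] (n : ℕ) :
    MeasurableSpace.comap (shift n) MeasurableSpace.pi ≤
      ⨆ k ≥ n, MeasurableSpace.comap (fun x : ℕ → α => x k) mα := by
  rw [MeasurableSpace.pi, MeasurableSpace.comap_iSup]
  refine iSup_le fun k => ?_
  rw [MeasurableSpace.comap_comp]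
  exact le_iSup₂_of_le (f := fun k (_ : k ≥ n) => MeasurableSpace.comap
    (fun x : ℕ → α => x k) mα) (n + k) (by simp) le_rfl

theorem iIndep_comap_eval :
    iIndep (fun k => MeasurableSpace.comap (fun x : ℕ → Γ => x k) inferInstance) (pathLaw m) :=
  (iIndepFun_iff_iIndep _ _ _).1 <| iIndepFun_infinitePi (P := fun _ : ℕ => m)
    (X := fun _ x => x) fun _ => measurable_id

theorem indepFun_restrict_shift (n : ℕ) :
    IndepFun (fun (x : ℕ → Γ) (t : Finset.range n) => x t) (shift n) (pathLaw m) := by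
  have h := indep_iSup_of_disjoint (S := Set.Iio n) (T := Set.Ici n)
    (fun i => (measurable_pi_apply i).comap_le) (iIndep_comap_eval m)
    (Set.disjoint_left.2 fun a ha hb => by simp at ha hb; omega)
  rw [IndepFun_iff_Indep]
  refine indep_of_indep_of_le_left (indep_of_indep_of_le_right h (comap_shift_le n)) ?_
  rw [MeasurableSpace.pi, MeasurableSpace.comap_iSup]
  refine iSup_le fun k => ?_
  rw [MeasurableSpace.comap_comp]
  exact le_iSup₂_of_le (f := fun i (_ : i ∈ Set.Iio n) => MeasurableSpace.comap
    (fun x : ℕ → Γ => x i) _) (k : ℕ) (by simpa using Finset.mem_range.1 k.2) le_rfl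

/-- Kolmogorov's zero-one law for shift-invariant events. -/
theorem pathLaw_eq_zero_or_one {B : Set (ℕ → Γ)} (hB : MeasurableSet B)
    (hinv : ∀ n, shift n ⁻¹' B = B) : pathLaw m B = 0 ∨ pathLaw m B = 1 := by
  refine measure_zero_or_one_of_measurableSet_limsup_atTop
    (fun k => (measurable_pi_apply k).comap_le) (iIndep_comap_eval m) ?_
  rw [limsup_eq_iInf_iSup_of_nat, MeasurableSpace.measurableSet_iInf]
  exact fun n => comap_shift_le n _ ⟨B, hB, hinv n⟩

variable [Group Γ] [Countable Γ] [DiscreteMeasurableSpace Γ]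

/-- A quantity that depends on the first `n` increments alone is independent of the later ones. It
is measurable because `Γ` is countable and discrete, so no measurability of `F` is assumed. -/
theorem indepFun_shift_of_prefix {α : Type*} [MeasurableSpace α] {F : (ℕ → Γ) → α} {n : ℕ}
    (hF : ∀ x y, (∀ k < n, x k = y k) → F x = F y) :
    IndepFun F (shift n) (pathLaw m) := by
  classical
  let e : (Finset.range n → Γ) → ℕ → Γ := fun r t => if h : t ∈ Finset.range n then r ⟨t, h⟩ else 1
  have h := (indepFun_restrict_shift m n).comp (φ := fun r => F (e r)) (ψ := id)
    (measurable_of_countable _) measurable_id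
  rw [Function.id_comp] at h
  convert h using 1
  ext1 x
  refine hF _ _ fun k hk => ?_
  simp [e, hk]

theorem measurable_pathProd (n : ℕ) : Measurable fun x : ℕ → Γ => pathProd x n := by
  induction n with
  | zero => exact measurable_const
  | succ n ih =>
    exact (measurable_of_countable fun p : Γ × Γ => p.1 * p.2).comp
      (ih.prodMk (measurable_pi_apply n))

theorem pathLaw_inter_shift (n : ℕ) (A : Set Γ) {B : Set (ℕ → Γ)} (hB : MeasurableSet B) :
    pathLaw m {x | pathProd x n ∈ A ∧ shift n x ∈ B} =
      pathLaw m {x | pathProd x n ∈ A} * pathLaw m B := by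
  have h := (indepFun_shift_of_prefix m (F := fun x => pathProd x n) (n := n)
    fun x y => pathProd_congr).measure_inter_preimage_eq_mul A B (.of_discrete) hB
  rw [(measurePreserving_shift m n).measure_preimage hB.nullMeasurableSet] at h
  exact h

end Independence

/-! ### The subadditive ergodic theorem for random walks -/

theorem tendsto_natDiv_div_atTop (k : ℕ) :
    Tendsto (fun n : ℕ => ((n / k : ℕ) : ℝ) / n) atTop (𝓝 (1 / k)) := by
  have h := (tendsto_nat_floor_mul_div_atTop (R := ℝ) (a := 1 / k) (by positivity)).comp
    tendsto_natCast_atTop_atTop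
  refine h.congr fun n => ?_
  simp only [Function.comp]
  rw [one_div_mul_eq_div, Nat.floor_div_natCast, Nat.floor_natCast]

section Integrals

variable {Γ : Type*} [MeasurableSpace Γ] {m : Measure Γ} [IsProbabilityMeasure m] {f : Γ → ℝ}

theorem integrable_apply_eval (hint : Integrable f m)
    (t : ℕ) : Integrable (fun x => f (x t)) (pathLaw m) :=
  (measurePreserving_eval_infinitePi (fun _ : ℕ => m) t).integrable_comp_of_integrable hint

variable (m)

theorem integral_apply_eval [Countable Γ] [DiscreteMeasurableSpace Γ] (f : Γ → ℝ)
    (t : ℕ) :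
    ∫ x, f (x t) ∂pathLaw m = ∫ g, f g ∂m := by
  rw [← integral_map (measurable_pi_apply t).aemeasurable
    (measurable_of_countable f).aestronglyMeasurable, Measure.infinitePi_map_eval]

theorem integral_comp_shift {F : (ℕ → Γ) → ℝ} (hF : Measurable F) (n : ℕ) :
    ∫ x, F (shift n x) ∂pathLaw m = ∫ x, F x ∂pathLaw m := by
  rw [← integral_map (measurable_shift n).aemeasurable hF.aestronglyMeasurable,
    (measurePreserving_shift m n).map_eq]

end Integrals

section Subadditive

variable {Γ : Type*} [Group Γ] {f : Γ → ℝ}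

theorem apply_pathProd_mul_le_sum (h1 : f 1 = 0) (hsub : ∀ g h, f (g * h) ≤ f g + f h)
    (x : ℕ → Γ) (k q : ℕ) :
    f (pathProd x (q * k)) ≤ ∑ j ∈ Finset.range q, f (pathProd (shift (j * k) x) k) := by
  induction q with
  | zero => simp [h1]
  | succ q ih =>
    rw [Finset.sum_range_succ, add_mul, one_mul, pathProd_add]
    exact (hsub _ _).trans (by gcongr)

open Classical in
/-- The cost of a unit step taken at the start of the path `x` when none of the first `N` steps
leads to a point where `f` is at most `b` times the elapsed time, and `0` otherwise. -/
noncomputable def badCost (f : Γ → ℝ) (b : ℝ) (N : ℕ) (x : ℕ → Γ) : ℝ :=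
  if ∃ k, 1 ≤ k ∧ k ≤ N ∧ f (pathProd x k) ≤ b * k then 0 else f (x 0)

theorem badCost_nonneg (h0 : ∀ g, 0 ≤ f g) (b : ℝ) (N : ℕ) (x : ℕ → Γ) :
    0 ≤ badCost f b N x := by
  unfold badCost
  split_ifs
  exacts [le_rfl, h0 _]

theorem badCost_le (h0 : ∀ g, 0 ≤ f g) (b : ℝ) (N : ℕ) (x : ℕ → Γ) :
    badCost f b N x ≤ f (x 0) := by
  unfold badCost
  split_ifs
  exacts [h0 _, le_rfl]

/-- The interval `[0, n)` is cut greedily into blocks: from time `t`, jump to a time within the next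
`N` steps at which `f` of the product of the increments since `t` is at most `b` times the elapsed
time, if there is one not later than `n`, and make a unit step otherwise. The second summand pays
for unit steps forced by the restriction to times up to `n`, which occur only in the last `N`
steps. -/
theorem apply_pathProd_le_badCost (h0 : ∀ g, 0 ≤ f g) (h1 : f 1 = 0)
    (hsub : ∀ g h, f (g * h) ≤ f g + f h) {b : ℝ} (hb : 0 ≤ b) (N n : ℕ) (x : ℕ → Γ) :
    f (pathProd x n) ≤ b * n + ∑ t ∈ Finset.range n,
      (badCost f b N (shift t x) + if n ≤ t + N then f (x t) else 0) := by
  induction n using Nat.strong_induction_on generalizing x with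
  | _ n ih =>
  have hnn : ∀ t, 0 ≤ badCost f b N (shift t x) + if n ≤ t + N then f (x t) else 0 := fun t =>
    add_nonneg (badCost_nonneg h0 _ _ _) (by split_ifs; exacts [h0 _, le_rfl])
  have key : ∀ k, 1 ≤ k → k ≤ n → f (pathProd x n) ≤ f (pathProd x k) + (b * (n - k : ℕ) +
      ∑ t ∈ Finset.range (n - k), (badCost f b N (shift (k + t) x) +
        if n ≤ k + t + N then f (x (k + t)) else 0)) := by
    intro k hk hkn
    have h := ih (n - k) (by omega) (shift k x)
    obtain ⟨r, rfl⟩ := Nat.exists_eq_add_of_le hkn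
    rw [pathProd_add]
    refine (hsub _ _).trans ?_
    simp only [Nat.add_sub_cancel_left] at h ⊢
    refine add_le_add le_rfl (h.trans_eq ?_)
    simp only [shift_shift, shift_apply, add_assoc, add_le_add_iff_left]
  by_cases hgood : ∃ k, 1 ≤ k ∧ k ≤ N ∧ k ≤ n ∧ f (pathProd x k) ≤ b * k
  · obtain ⟨k, hk1, -, hkn, hk⟩ := hgood
    refine (key k hk1 hkn).trans ?_
    obtain ⟨r, rfl⟩ := Nat.exists_eq_add_of_le hkn
    rw [Finset.sum_range_add]
    have := Finset.sum_nonneg fun t (_ : t ∈ Finset.range k) => hnn t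
    simp only [Nat.add_sub_cancel_left]
    push_cast
    linarith
  · rcases Nat.eq_zero_or_pos n with rfl | hn
    · simp [h1]
    refine (key 1 le_rfl hn).trans ?_
    obtain ⟨r, rfl⟩ := Nat.exists_eq_add_of_le hn
    rw [Finset.sum_range_add]
    have hx : f (x 0) ≤
        badCost f b N (shift 0 x) + if 1 + r ≤ 0 + N then f (x 0) else 0 := by
      by_cases hN : 1 + r ≤ 0 + N
      · rw [if_pos hN]
        linarith [badCost_nonneg h0 b N (shift 0 x)]
      · rw [if_neg hN, badCost, if_neg]
        · simp
        · rintro ⟨k, hk1, hkN, hk⟩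
          exact hgood ⟨k, hk1, hkN, by omega, by simpa using hk⟩
    simp only [Nat.add_sub_cancel_left, Finset.sum_range_one, pathProd_one]
    push_cast
    linarith

/-- The set of paths along which `f (pathProd x n) - b * n` is unbounded below. Unlike the event
that the lower limit of `f (pathProd x n) / n` is less than `b`, it is seen to be shift-invariant
without any adjustment of `b`. -/
def dipSet (f : Γ → ℝ) (b : ℝ) : Set (ℕ → Γ) :=
  {x | ∀ C : ℕ, ∃ n : ℕ, f (pathProd x n) ≤ b * n - C}

theorem preimage_shift_dipSet (h0 : ∀ g, 0 ≤ f g) (hsub : ∀ g h, f (g * h) ≤ f g + f h) {b : ℝ}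
    (hb : 0 ≤ b) (n : ℕ) : shift n ⁻¹' dipSet f b = dipSet f b := by
  ext x
  constructor
  · intro hx C
    obtain ⟨D, hD⟩ := exists_nat_ge (C + f (pathProd x n))
    obtain ⟨k, hk⟩ := hx D
    refine ⟨n + k, ?_⟩
    rw [pathProd_add]
    have := hsub (pathProd x n) (pathProd (shift n x) k)
    have : 0 ≤ b * n := by positivity
    push_cast
    linarith
  · intro hx C
    obtain ⟨D, hD⟩ := exists_nat_gt (C + f (pathProd x n)⁻¹ + b * n)
    obtain ⟨k, hk⟩ := hx D
    have hnk : n ≤ k := by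
      by_contra! hlt
      have h2 : b * k ≤ b * n := by gcongr
      have := h0 (pathProd x k)
      have := h0 (pathProd x n)⁻¹
      have : (0 : ℝ) ≤ C := by positivity
      linarith
    obtain ⟨r, rfl⟩ := Nat.exists_eq_add_of_le hnk
    refine ⟨r, ?_⟩
    have h2 := hsub (pathProd x n)⁻¹ (pathProd x (n + r))
    rw [pathProd_add, inv_mul_cancel_left, ← pathProd_add] at h2
    push_cast at hk
    linarith

variable [MeasurableSpace Γ] [Countable Γ] [DiscreteMeasurableSpace Γ]
  {m : Measure Γ} [IsProbabilityMeasure m]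

theorem measurable_apply_pathProd (f : Γ → ℝ) (n : ℕ) :
    Measurable fun x : ℕ → Γ => f (pathProd x n) :=
  (measurable_of_countable f).comp (measurable_pathProd n)

theorem integrable_apply_pathProd (h0 : ∀ g, 0 ≤ f g) (h1 : f 1 = 0)
    (hsub : ∀ g h, f (g * h) ≤ f g + f h) (hint : Integrable f m) (n : ℕ) :
    Integrable (fun x => f (pathProd x n)) (pathLaw m) := by
  refine (integrable_finsetSum (Finset.range n)
    fun t _ => integrable_apply_eval hint t).mono'
    (measurable_apply_pathProd f n).aestronglyMeasurable (ae_of_all _ fun x => ?_)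
  rw [Real.norm_of_nonneg (h0 _)]
  exact apply_pathProd_le_sum h1 hsub x n

theorem subadditive_integral_apply_pathProd (h0 : ∀ g, 0 ≤ f g) (h1 : f 1 = 0)
    (hsub : ∀ g h, f (g * h) ≤ f g + f h) (hint : Integrable f m) :
    Subadditive fun n => ∫ x, f (pathProd x n) ∂pathLaw m := by
  intro k n
  have hi := integrable_apply_pathProd h0 h1 hsub hint
  have hs : Integrable (fun x => f (pathProd (shift k x) n)) (pathLaw m) :=
    (measurePreserving_shift m k).integrable_comp_of_integrable (hi n)
  calc ∫ x, f (pathProd x (k + n)) ∂pathLaw m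
      ≤ ∫ x, (f (pathProd x k) + f (pathProd (shift k x) n)) ∂pathLaw m :=
        integral_mono (hi _) ((hi k).add hs) fun x => by
          simpa only [pathProd_add] using hsub _ _
    _ = _ := by
      rw [integral_add (hi k) hs,
        integral_comp_shift m (measurable_apply_pathProd f n) k]

/-- The upper half of the subadditive ergodic theorem: the strong law of large numbers, applied to
blocks of `k` increments. -/
theorem eventually_apply_pathProd_div_lt (h0 : ∀ g, 0 ≤ f g) (h1 : f 1 = 0)
    (hsub : ∀ g h, f (g * h) ≤ f g + f h) (hint : Integrable f m) {k : ℕ} (hk : k ≠ 0) {b : ℝ}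
    (hb : (∫ x, f (pathProd x k) ∂pathLaw m) / k < b) :
    ∀ᵐ x ∂pathLaw m, ∀ᶠ n : ℕ in atTop, f (pathProd x n) / n < b := by
  -- Blocks of length `j` are needed for `j = k`, and for `j = 1` to control the last, incomplete
  -- block.
  have slln : ∀ j : ℕ, ∀ᵐ x ∂pathLaw m,
      Tendsto (fun q : ℕ => (∑ i ∈ Finset.range q, f (pathProd (shift (i * j) x) j)) / q) atTop
        (𝓝 (∫ x, f (pathProd x j) ∂pathLaw m)) := by
    intro j
    have hm := measurable_apply_pathProd f j
    have h := strong_law_ae_real (μ := pathLaw m) (fun i x => f (pathProd (shift (i * j) x) j))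
      (by simpa using integrable_apply_pathProd h0 h1 hsub hint j) ?_ fun i => ?_
    · simpa using h
    · have hlt : ∀ a c, a < c → IndepFun (fun x => f (pathProd (shift (a * j) x) j))
          (fun x => f (pathProd (shift (c * j) x) j)) (pathLaw m) := by
        intro a c hac
        refine (indepFun_shift_of_prefix m (n := c * j) fun x y hxy => ?_).comp measurable_id hm
        refine congrArg f (pathProd_congr fun t ht => hxy _ ?_)
        calc a * j + t < a * j + j := by omega
          _ = (a + 1) * j := by ring
          _ ≤ c * j := Nat.mul_le_mul_right _ hac
      intro a c hac
      rcases lt_or_gt_of_ne hac with h | h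
      exacts [hlt a c h, (hlt c a h).symm]
    · have hp : ∀ i, (pathLaw m).map (fun x => f (pathProd (shift (i * j) x) j)) =
          (pathLaw m).map fun x => f (pathProd x j) := by
        intro i
        rw [← (measurePreserving_shift m (i * j)).map_eq,
          Measure.map_map hm (measurable_shift _), (measurePreserving_shift m (i * j)).map_eq]
        rfl
      exact ⟨(hm.comp (measurable_shift _)).aemeasurable,
        (hm.comp (measurable_shift _)).aemeasurable, (hp i).trans (hp 0).symm⟩
  have hk0 : (0 : ℝ) < k := by positivity
  filter_upwards [slln k, slln 1] with x hY hS
  simp only [mul_one, pathProd_one, shift_apply, add_zero] at hS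
  set Y : ℕ → ℝ := fun q => ∑ i ∈ Finset.range q, f (pathProd (shift (i * k) x) k)
  set S : ℕ → ℝ := fun q => ∑ i ∈ Finset.range q, f (x i)
  have hq : Tendsto (fun n : ℕ => n / k) atTop atTop := Nat.tendsto_div_const_atTop hk
  have hqk : Tendsto (fun n : ℕ => n / k * k) atTop atTop := hq.atTop_mul_const' (by omega)
  have hqn := tendsto_natDiv_div_atTop k
  have hU : Tendsto (fun n : ℕ => Y (n / k) / (n / k : ℕ) * (((n / k : ℕ) : ℝ) / n) +
      (S n / n - S (n / k * k) / (n / k * k : ℕ) * (((n / k : ℕ) : ℝ) / n * k))) atTop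
      (𝓝 ((∫ x, f (pathProd x k) ∂pathLaw m) * (1 / k) +
        ((∫ x, f (x 0) ∂pathLaw m) - (∫ x, f (x 0) ∂pathLaw m) * (1 / k * k)))) := 
    ((hY.comp hq).mul hqn).add (hS.sub ((hS.comp hqk).mul (hqn.mul_const _)))
  rw [one_div_mul_cancel hk0.ne', mul_one, sub_self, add_zero, mul_one_div] at hU
  filter_upwards [hU.eventually_lt_const hb, eventually_ge_atTop k] with n hn hkn
  refine lt_of_le_of_lt ?_ hn
  have hqpos : (0 : ℝ) < (n / k : ℕ) := by exact_mod_cast Nat.div_pos hkn (by omega)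
  have hnpos : (0 : ℝ) < n := by exact_mod_cast (by omega : 0 < n)
  have hmain : f (pathProd x n) ≤ Y (n / k) + (S n - S (n / k * k)) := by
    have hn' : n / k * k + n % k = n := by rw [mul_comm]; exact Nat.div_add_mod n k
    have hSn : S n - S (n / k * k) = ∑ t ∈ Finset.range (n % k), f (shift (n / k * k) x t) := by
      rw [sub_eq_iff_eq_add']
      conv_lhs => rw [← hn']
      exact Finset.sum_range_add _ _ _
    rw [hSn]
    conv_lhs => rw [← hn', pathProd_add]
    exact (hsub _ _).trans (add_le_add (apply_pathProd_mul_le_sum h1 hsub x k _)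
      (apply_pathProd_le_sum h1 hsub _ _))
  calc f (pathProd x n) / n ≤ (Y (n / k) + (S n - S (n / k * k))) / n := by gcongr
    _ = _ := by push_cast; field_simp

theorem measurableSet_dipSet (f : Γ → ℝ) (b : ℝ) : MeasurableSet (dipSet f b) := by
  simp only [dipSet, Set.ofPred_forall, Set.ofPred_exists]
  exact .iInter fun C => .iUnion fun n =>
    measurableSet_le (measurable_apply_pathProd f n) measurable_const

/-- The lower half of the subadditive ergodic theorem. If the path dipped below slope `b` almost
surely, cutting it at such dips would bound the mean slope by `b`. -/
theorem pathLaw_dipSet_eq_zero (h0 : ∀ g, 0 ≤ f g) (h1 : f 1 = 0)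
    (hsub : ∀ g h, f (g * h) ≤ f g + f h) (hint : Integrable f m) {b γ : ℝ} (hb : 0 ≤ b)
    (hbγ : b < γ)
    (hγ : Tendsto (fun n : ℕ => (∫ x, f (pathProd x n) ∂pathLaw m) / n) atTop (𝓝 γ)) :
    pathLaw m (dipSet f b) = 0 := by
  refine (pathLaw_eq_zero_or_one m (measurableSet_dipSet f b)
    (preimage_shift_dipSet h0 hsub hb)).resolve_right fun hone => hbγ.not_ge ?_
  have hdip : ∀ᵐ x ∂pathLaw m, x ∈ dipSet f b :=
    (mem_ae_iff_prob_eq_one (measurableSet_dipSet f b)).2 hone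
  have hmeas : ∀ N, Measurable (badCost f b N) := by
    intro N
    refine Measurable.ite ?_ measurable_const
      ((measurable_of_countable f).comp (measurable_pi_apply 0))
    simp only [Set.ofPred_exists, Set.ofPred_and]
    exact .iUnion fun k => (MeasurableSet.const _).inter <| (MeasurableSet.const _).inter <|
      measurableSet_le (measurable_apply_pathProd f k) measurable_const
  have hbad_int : ∀ N, Integrable (badCost f b N) (pathLaw m) := fun N =>
    (integrable_apply_eval hint 0).mono' (hmeas N).aestronglyMeasurable <| ae_of_all _ fun x => by
      rw [Real.norm_of_nonneg (badCost_nonneg h0 _ _ _)]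
      exact badCost_le h0 _ _ _
  -- Almost every path dips within some finite time, so the cost of the unit steps vanishes
  -- as `N → ∞`.
  have hbad : Tendsto (fun N => ∫ x, badCost f b N x ∂pathLaw m) atTop (𝓝 0) := by
    have h := tendsto_integral_of_dominated_convergence (μ := pathLaw m)
      (F := fun N => badCost f b N) (f := fun _ => 0)
      (fun x => f (x 0)) (fun N => (hmeas N).aestronglyMeasurable) (integrable_apply_eval hint 0)
      (fun N => ae_of_all _ fun x => by
        rw [Real.norm_of_nonneg (badCost_nonneg h0 _ _ _)]
        exact badCost_le h0 _ _ _) ?_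
    · simpa using h
    · filter_upwards [hdip] with x hx
      obtain ⟨k, hk⟩ := hx 1
      have hk1 : 1 ≤ k := by
        rw [Nat.one_le_iff_ne_zero]
        rintro rfl
        norm_num [h1] at hk
      refine tendsto_const_nhds.congr' ?_
      filter_upwards [eventually_ge_atTop k] with N hN
      rw [badCost, if_pos ⟨k, hk1, hN, hk.trans (by norm_num)⟩]
  have hmean : ∀ N, γ ≤ b + ∫ x, badCost f b N x ∂pathLaw m := by
    intro N
    have hshift : ∀ t, Integrable (fun x => badCost f b N (shift t x)) (pathLaw m) := fun t =>
      (measurePreserving_shift m t).integrable_comp_of_integrable (hbad_int N)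
    have htail : ∀ n t, Integrable (fun x : ℕ → Γ => if n ≤ t + N then f (x t) else 0)
        (pathLaw m) := by
      intro n t
      split_ifs
      exacts [integrable_apply_eval hint t, integrable_zero _ _ _]
    have hn : ∀ n : ℕ, ∫ x, f (pathProd x n) ∂pathLaw m ≤
        b * n + (n * (∫ x, badCost f b N x ∂pathLaw m) + N * ∫ g, f g ∂m) := by
      intro n
      have hterm : ∀ t, Integrable (fun x => badCost f b N (shift t x) +
          if n ≤ t + N then f (x t) else 0) (pathLaw m) := fun t => (hshift t).add (htail n t)
      have hsum : Integrable (fun x => ∑ t ∈ Finset.range n, (badCost f b N (shift t x) +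
          if n ≤ t + N then f (x t) else 0)) (pathLaw m) :=
        integrable_finsetSum (Finset.range n) fun t _ => hterm t
      calc ∫ x, f (pathProd x n) ∂pathLaw m
          ≤ ∫ x, (b * n + ∑ t ∈ Finset.range n, (badCost f b N (shift t x) +
              if n ≤ t + N then f (x t) else 0)) ∂pathLaw m :=
            integral_mono (integrable_apply_pathProd h0 h1 hsub hint n)
              ((integrable_const _).add hsum) (apply_pathProd_le_badCost h0 h1 hsub hb N n)
        _ = b * n + ∑ t ∈ Finset.range n, ((∫ x, badCost f b N x ∂pathLaw m) +
              if n ≤ t + N then ∫ g, f g ∂m else 0) := by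
            rw [integral_add (integrable_const _) hsum, integral_finsetSum _ fun t _ => hterm t]
            simp only [integral_const, probReal_univ, one_smul]
            congr 1
            refine Finset.sum_congr rfl fun t _ => ?_
            rw [integral_add (hshift t) (htail n t), integral_comp_shift m (hmeas N)]
            congr 1
            split_ifs
            exacts [integral_apply_eval m f t, by simp]
        _ ≤ _ := by
            rw [Finset.sum_add_distrib, Finset.sum_const, Finset.card_range, nsmul_eq_mul,
              ← Finset.sum_filter, Finset.sum_const, nsmul_eq_mul]
            have hcard : ((Finset.range n).filter fun t => n ≤ t + N).card ≤ N := by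
              calc _ ≤ (Finset.Ico (n - N) n).card := Finset.card_le_card fun t ht => by
                    simp at ht ⊢; omega
                _ ≤ N := by simp; omega
            have : 0 ≤ ∫ g, f g ∂m := integral_nonneg fun g => h0 g
            gcongr
    have hlim : Tendsto (fun n : ℕ => (b + ∫ x, badCost f b N x ∂pathLaw m) +
        (N * ∫ g, f g ∂m) / n) atTop (𝓝 ((b + ∫ x, badCost f b N x ∂pathLaw m) + 0)) :=
      tendsto_const_nhds.add (tendsto_const_div_atTop_nhds_zero_nat _)
    rw [add_zero] at hlim
    refine le_of_tendsto_of_tendsto hγ hlim ?_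
    filter_upwards [eventually_gt_atTop 0] with n hn0
    have : (0 : ℝ) < n := by exact_mod_cast hn0
    rw [div_le_iff₀ this]
    refine (hn n).trans_eq ?_
    field_simp
    ring
  have h := hbad.const_add b
  rw [add_zero] at h
  exact ge_of_tendsto' h hmean

/-- The subadditive ergodic theorem for a subadditive integrable function `f ≥ 0` of a random walk
on a countable group. The almost sure speed is also the limit of the mean speeds. -/
theorem exists_tendsto_apply_pathProd_div (h0 : ∀ g, 0 ≤ f g) (h1 : f 1 = 0)
    (hsub : ∀ g h, f (g * h) ≤ f g + f h) (hint : Integrable f m) :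
    ∃ γ : ℝ, (∀ᵐ x ∂pathLaw m, Tendsto (fun n : ℕ => f (pathProd x n) / n) atTop (𝓝 γ)) ∧
      Tendsto (fun n : ℕ => (∫ x, f (pathProd x n) ∂pathLaw m) / n) atTop (𝓝 γ) := by
  have ha := subadditive_integral_apply_pathProd h0 h1 hsub hint
  have hlim := ha.tendsto_lim ⟨0, by
    rintro _ ⟨n, rfl⟩
    exact div_nonneg (integral_nonneg fun x => h0 _) n.cast_nonneg⟩
  set γ := ha.lim
  refine ⟨γ, ?_, hlim⟩
  have hupper : ∀ᵐ x ∂pathLaw m, ∀ b : ℚ, γ < b → ∀ᶠ n : ℕ in atTop, f (pathProd x n) / n < b := by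
    refine ae_all_iff.2 fun b => ae_all_iff.2 fun hb => ?_
    obtain ⟨k, hk, hk0⟩ := ((hlim.eventually_lt_const hb).and (eventually_ne_atTop 0)).exists
    exact eventually_apply_pathProd_div_lt h0 h1 hsub hint hk0 hk
  have hlower : ∀ᵐ x ∂pathLaw m, ∀ b : ℚ, (0 : ℝ) ≤ b → b < γ → x ∉ dipSet f b := by
    refine ae_all_iff.2 fun b => ae_all_iff.2 fun hb0 => ae_all_iff.2 fun hb => ?_
    exact measure_eq_zero_iff_ae_notMem.1 (pathLaw_dipSet_eq_zero h0 h1 hsub hint hb0 hb hlim)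
  filter_upwards [hupper, hlower] with x hu hl
  refine tendsto_order.2 ⟨fun b hb => ?_, fun b hb => ?_⟩
  · rcases lt_or_ge b 0 with hneg | hb0
    · exact .of_forall fun n => hneg.trans_le (div_nonneg (h0 _) n.cast_nonneg)
    obtain ⟨b', hbb', hb'⟩ := exists_rat_btwn hb
    have h := hl b' (hb0.trans hbb'.le) hb'
    simp only [dipSet, Set.mem_ofPred_eq, not_forall, not_exists, not_le] at h
    obtain ⟨C, hC⟩ := h
    obtain ⟨N, hN⟩ := exists_nat_gt (C / (b' - b))
    filter_upwards [eventually_gt_atTop N] with n hn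
    have hn' : (N : ℝ) < n := by exact_mod_cast hn
    have hn0 : (0 : ℝ) < n := by exact_mod_cast (Nat.zero_le N).trans_lt hn
    rw [lt_div_iff₀ hn0]
    rw [div_lt_iff₀ (by linarith)] at hN
    have : (N : ℝ) * (b' - b) ≤ n * (b' - b) :=
      mul_le_mul_of_nonneg_right hn'.le (by linarith)
    linarith [hC n]
  · obtain ⟨b', hb', hbb'⟩ := exists_rat_btwn hb
    exact (hu b' hb').mono fun n hn => hn.trans hbb'

end Subadditive

/-! ### Word distances -/

section WordDist

variable {Γ : Type*} [Group Γ] {S : Set Γ} {l : Γ → ℝ}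

theorem list_sum_nonneg {α : Type*} {S : Set α} {l : α → ℝ} (hl : ∀ s ∈ S, 0 ≤ l s) {w : List α}
    (hw : ∀ s ∈ w, s ∈ S) :
    0 ≤ (w.map l).sum :=
  List.sum_nonneg fun r hr => by
    obtain ⟨s, hs, rfl⟩ := List.mem_map.1 hr
    exact hl s (hw s hs)

theorem wordDist_nonneg (hl : ∀ s ∈ S, 0 ≤ l s) (x y : Γ) : 0 ≤ wordDist S l x y :=
  Real.sInf_nonneg fun _ ⟨_, hw, _, hr⟩ => hr ▸ list_sum_nonneg hl hw

theorem wordDist_prod_le (hl : ∀ s ∈ S, 0 ≤ l s) {w : List Γ} (hw : ∀ s ∈ w, s ∈ S) :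
    wordDist S l 1 w.prod ≤ (w.map l).sum :=
  csInf_le ⟨0, fun r ⟨_, hv, _, hr⟩ => hr ▸ list_sum_nonneg hl hv⟩ ⟨w, hw, by simp, rfl⟩

theorem wordDist_one_one (hl : ∀ s ∈ S, 0 ≤ l s) : wordDist S l 1 1 = 0 :=
  le_antisymm (by simpa using wordDist_prod_le hl (w := []) (by simp)) (wordDist_nonneg hl 1 1)

theorem wordDist_le_of_mem (hl : ∀ s ∈ S, 0 ≤ l s) {s : Γ} (hs : s ∈ S) :
    wordDist S l 1 s ≤ l s := by
  simpa using wordDist_prod_le hl (w := [s]) (by simpa)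

theorem exists_list_of_closure_eq_top (hS : Submonoid.closure S = ⊤) (x : Γ) :
    ∃ w : List Γ, (∀ s ∈ w, s ∈ S) ∧ w.prod = x :=
  Submonoid.exists_list_of_mem_closure (hS ▸ Submonoid.mem_top x)

theorem exists_word_lt (hS : Submonoid.closure S = ⊤) (x : Γ) {ε : ℝ} (hε : 0 < ε) :
    ∃ w : List Γ, (∀ s ∈ w, s ∈ S) ∧ w.prod = x ∧ (w.map l).sum < wordDist S l 1 x + ε := by
  obtain ⟨v, hv, hx⟩ := exists_list_of_closure_eq_top hS x
  obtain ⟨_, ⟨w, hw, hw', rfl⟩, hlt⟩ := Real.lt_sInf_add_pos (s := {r : ℝ | ∃ w : List Γ,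
    (∀ s ∈ w, s ∈ S) ∧ x = 1 * w.prod ∧ r = (w.map l).sum}) ⟨_, v, hv, by simp [hx], rfl⟩ hε
  exact ⟨w, hw, by simpa using hw'.symm, hlt⟩

theorem wordDist_mul_le (hS : Submonoid.closure S = ⊤) (hl : ∀ s ∈ S, 0 ≤ l s) (x y : Γ) :
    wordDist S l 1 (x * y) ≤ wordDist S l 1 x + wordDist S l 1 y := by
  refine le_of_forall_pos_le_add fun ε hε => ?_
  obtain ⟨v, hv, rfl, hv'⟩ := exists_word_lt (l := l) hS x (half_pos hε)
  obtain ⟨w, hw, rfl, hw'⟩ := exists_word_lt (l := l) hS y (half_pos hε)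
  have := wordDist_prod_le hl (w := v ++ w) (by simpa [or_imp, forall_and] using ⟨hv, hw⟩)
  rw [List.prod_append, List.map_append, List.sum_append] at this
  linarith

/-- The word distance from the identity is the largest subadditive function vanishing at the
identity and bounded by the lengths on the generators. -/
theorem le_wordDist_of_subadditive (hS : Submonoid.closure S = ⊤) {F : Γ → ℝ} (h1 : F 1 = 0)
    (hsub : ∀ g h, F (g * h) ≤ F g + F h) (hF : ∀ s ∈ S, F s ≤ l s) (x : Γ) :
    F x ≤ wordDist S l 1 x := by
  have key : ∀ w : List Γ, (∀ s ∈ w, s ∈ S) → F w.prod ≤ (w.map l).sum := by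
    intro w
    induction w with
    | nil => simp [h1]
    | cons a w ih =>
      intro hw
      simp only [List.mem_cons, forall_eq_or_imp] at hw
      rw [List.prod_cons, List.map_cons, List.sum_cons]
      exact (hsub _ _).trans (add_le_add (hF a hw.1) (ih hw.2))
  obtain ⟨v, hv, hx⟩ := exists_list_of_closure_eq_top hS x
  refine le_csInf ⟨_, v, hv, by simp [hx], rfl⟩ ?_
  rintro _ ⟨w, hw, rfl, rfl⟩
  simpa using key w hw

theorem finite_wordDist_le (hSfin : S.Finite) (hS : Submonoid.closure S = ⊤)
    (hl : ∀ s ∈ S, 0 < l s) (R : ℝ) : {y | wordDist S l 1 y ≤ R}.Finite := by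
  obtain ⟨δ, hδ, hδl⟩ : ∃ δ > 0, ∀ s ∈ S, δ ≤ l s := by
    rcases S.eq_empty_or_nonempty with rfl | hne
    · exact ⟨1, one_pos, by simp⟩
    · obtain ⟨s, hs, hmin⟩ := Set.exists_min_image S l hSfin hne
      exact ⟨l s, hl s hs, hmin⟩
  obtain ⟨N, hN⟩ := exists_nat_ge ((R + 1) / δ)
  have := hSfin.to_subtype
  refine ((List.finite_length_le S N).image fun w => (w.map Subtype.val).prod).subset ?_
  intro y hy
  obtain ⟨w, hw, rfl, hlt⟩ := exists_word_lt (l := l) hS y one_pos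
  have hlen : w.length * δ ≤ (w.map l).sum := by
    have := List.card_nsmul_le_sum (w.map l) δ fun r hr => by
      obtain ⟨s, hs, rfl⟩ := List.mem_map.1 hr
      exact hδl s (hw s hs)
    simpa using this
  lift w to List S using hw
  refine ⟨w, ?_, rfl⟩
  have h2 : (w.length : ℝ) ≤ N := by
    refine le_trans ((le_div_iff₀ hδ).2 ?_) hN
    simp only [List.length_map] at hlen
    have : wordDist S l 1 (w.map Subtype.val).prod ≤ R := hy
    linarith
  exact_mod_cast h2

theorem countable_of_closure_eq_top (hSc : S.Countable) (hS : Submonoid.closure S = ⊤) :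
    Countable Γ := by
  have := hSc.to_subtype
  refine Function.Surjective.countable (f := fun w : List S => (w.map Subtype.val).prod) fun x => ?_
  obtain ⟨w, hw, rfl⟩ := exists_list_of_closure_eq_top hS x
  lift w to List S using hw
  exact ⟨w, rfl⟩

end WordDist

/-! ### Lengths in the lamplighter group -/

namespace Lamplighter

variable {G : Type*} [Group G]

instance [Countable G] : Countable (Lamplighter G) :=
  Function.Injective.countable (f := fun g : Lamplighter G => (g.lamps, g.pos))
    fun g h hgh => by
      rw [Prod.mk.injEq] at hgh
      exact Lamplighter.ext hgh.1 hgh.2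

instance : DiscreteMeasurableSpace (Lamplighter G) := ⟨fun _ => trivial⟩

/-- The projection of the lamplighter group onto the base group. -/
def posHom : Lamplighter G →* G where
  toFun := pos
  map_one' := rfl
  map_mul' _ _ := rfl

/-- The embedding of the base group as the group of movements of the lamplighter. -/
noncomputable def stepHom : G →* Lamplighter G where
  toFun := step
  map_one' := rfl
  map_mul' x y := by ext <;> simp [step]

/-- The element that switches the lamp at `y`, with the lamplighter back at the identity. -/
noncomputable def lampAt (y : G) : Lamplighter G := ⟨Finsupp.single y 1, 1⟩

theorem lampAt_eq (y : G) : lampAt y = step y * switch * step y⁻¹ := by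
  classical
  refine Lamplighter.ext (Finsupp.ext fun w => ?_) (by simp [lampAt, step, switch])
  simp [lampAt, step, switch, Finsupp.single_apply, eq_inv_mul_iff_mul_eq]

theorem card_support_translate (x : G) (η : G →₀ ZMod 2) :
    (translate x η).support.card = η.support.card := by
  simp [translate, Finsupp.equivMapDomain]

theorem card_support_mul_le (g h : Lamplighter G) :
    (g * h).lamps.support.card ≤ g.lamps.support.card + h.lamps.support.card := by
  classical
  rw [mul_lamps, ← card_support_translate g.pos h.lamps]
  exact (Finset.card_le_card Finsupp.support_add).trans (Finset.card_union_le _ _)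

theorem eq_lampAt_mul {y : G} {η : G →₀ ZMod 2} {a : ZMod 2} (ha : a ≠ 0) :
    (⟨Finsupp.single y a + η, 1⟩ : Lamplighter G) = lampAt y * ⟨η, 1⟩ := by
  have : a = 1 := by revert ha; revert a; decide
  subst this
  ext w <;> simp [lampAt]

theorem eq_mul_step (η : G →₀ ZMod 2) (x : G) : (⟨η, x⟩ : Lamplighter G) = ⟨η, 1⟩ * step x := by
  ext w <;> simp [step]

theorem closure_generators {S : Set G} (hS : Submonoid.closure S = ⊤) :
    Submonoid.closure (generators S) = ⊤ := by
  have hstep : ∀ x, step x ∈ Submonoid.closure (generators S) := fun x => by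
    have h : stepHom x ∈ (Submonoid.closure S).map stepHom := ⟨x, hS ▸ Submonoid.mem_top x, rfl⟩
    rw [MonoidHom.map_mclosure] at h
    exact Submonoid.closure_mono (Set.subset_insert _ _) h
  have hlamp : ∀ y, lampAt y ∈ Submonoid.closure (generators S) := fun y => by
    rw [lampAt_eq]
    exact mul_mem (mul_mem (hstep _) (Submonoid.subset_closure (Set.mem_insert _ _))) (hstep _)
  refine (Submonoid.eq_top_iff' _).2 fun g => ?_
  obtain ⟨η, x⟩ := g
  rw [eq_mul_step]
  refine mul_mem ?_ (hstep x)
  induction η using Finsupp.induction with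
  | zero => exact one_mem _
  | single_add y a η _ ha ih =>
    rw [eq_lampAt_mul ha]
    exact mul_mem (hlamp y) ih

variable {S : Set G} {l : G → ℝ} {c : ℝ}

theorem genLength_switch : genLength l c (switch : Lamplighter G) = c := if_pos rfl

theorem genLength_step (s : G) : genLength l c (step s) = l s := by
  refine if_neg fun h => ?_
  have := congrArg (fun g : Lamplighter G => g.lamps 1) h
  simp [step, switch] at this

theorem genLength_nonneg (hl : ∀ s ∈ S, 0 ≤ l s) (hc : 0 ≤ c) :
    ∀ g ∈ generators S, 0 ≤ genLength l c g := by
  rintro g (rfl | ⟨s, hs, rfl⟩)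
  · rwa [genLength_switch]
  · rw [genLength_step]
    exact hl s hs

theorem length_nonneg (hl : ∀ s ∈ S, 0 ≤ l s) (hc : 0 ≤ c) (g : Lamplighter G) :
    0 ≤ Lamplighter.length S l c g :=
  wordDist_nonneg (genLength_nonneg hl hc) 1 g

theorem length_one (hl : ∀ s ∈ S, 0 ≤ l s) (hc : 0 ≤ c) :
    Lamplighter.length S l c (1 : Lamplighter G) = 0 :=
  wordDist_one_one (genLength_nonneg hl hc)

theorem length_mul_le (hS : Submonoid.closure S = ⊤) (hl : ∀ s ∈ S, 0 ≤ l s) (hc : 0 ≤ c)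
    (g h : Lamplighter G) :
    Lamplighter.length S l c (g * h) ≤ Lamplighter.length S l c g + Lamplighter.length S l c h :=
  wordDist_mul_le (closure_generators hS) (genLength_nonneg hl hc) g h

theorem length_step_le (hS : Submonoid.closure S = ⊤) (hl : ∀ s ∈ S, 0 ≤ l s) (hc : 0 ≤ c)
    (x : G) : Lamplighter.length S l c (step x) ≤ wordDist S l 1 x := by
  refine le_wordDist_of_subadditive (F := fun x => Lamplighter.length S l c (step x)) hS
    (length_one hl hc) (fun g h => ?_) (fun s hs => ?_) x
  · have := length_mul_le hS hl hc (step g) (step h)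
    rwa [show step g * step h = step (g * h) from (stepHom.map_mul g h).symm] at this
  · refine (wordDist_le_of_mem (genLength_nonneg hl hc) (Or.inr ⟨s, hs, rfl⟩)).trans_eq ?_
    exact genLength_step s

theorem length_le_sum_add (hS : Submonoid.closure S = ⊤) (hl : ∀ s ∈ S, 0 ≤ l s) (hc : 0 ≤ c)
    (g : Lamplighter G) :
    Lamplighter.length S l c g ≤
      ∑ y ∈ g.lamps.support, Lamplighter.length S l c (lampAt y) + wordDist S l 1 g.pos := by
  classical
  obtain ⟨η, x⟩ := g
  rw [eq_mul_step]
  refine (length_mul_le hS hl hc _ _).trans (add_le_add ?_ ?_)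
  · have : ((⟨η, 1⟩ : Lamplighter G) * step x).lamps = η := by ext w; simp [step]
    rw [this]
    induction η using Finsupp.induction with
    | zero => exact (length_one hl hc).le
    | single_add y a η hy ha ih =>
      rw [eq_lampAt_mul ha, Finsupp.support_single_add hy ha, Finset.sum_cons]
      exact (length_mul_le hS hl hc _ _).trans
        (by gcongr; exact ih (by ext w; simp [step]))
  · simpa [step] using length_step_le hS hl hc x

/-- A word for `g` contains a word for its position and at least one switch for each lit lamp. -/
theorem wordDist_add_le_length (hS : Submonoid.closure S = ⊤) (hl : ∀ s ∈ S, 0 ≤ l s)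
    (hc : 0 ≤ c) (g : Lamplighter G) :
    wordDist S l 1 g.pos + c * g.lamps.support.card ≤ Lamplighter.length S l c g := by
  refine le_wordDist_of_subadditive
    (F := fun g : Lamplighter G => wordDist S l 1 g.pos + c * g.lamps.support.card)
    (closure_generators hS) (by simp [wordDist_one_one hl]) (fun g h => ?_) ?_ g
  · have h1 := wordDist_mul_le hS hl g.pos h.pos
    have h2 : ((g * h).lamps.support.card : ℝ) ≤
        g.lamps.support.card + h.lamps.support.card := by
      exact_mod_cast card_support_mul_le g h
    have h3 := mul_le_mul_of_nonneg_left h2 hc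
    rw [← mul_pos] at h1
    linarith
  · rintro g (rfl | ⟨s, hs, rfl⟩)
    · rw [genLength_switch]
      simp [switch, wordDist_one_one hl]
    · rw [genLength_step]
      simpa [step] using wordDist_le_of_mem hl hs

end Lamplighter

/-! ### Transience -/

section Transience

variable {Γ H : Type*} [Group Γ] [Group H] [MeasurableSpace Γ] [Countable Γ]
  [DiscreteMeasurableSpace Γ] (m : Measure Γ) [IsProbabilityMeasure m]

/-- The paths whose image under `φ` never returns to the identity. -/
def noReturn (φ : Γ →* H) : Set (ℕ → Γ) := {x | ∀ n : ℕ, 1 ≤ n → φ (pathProd x n) ≠ 1}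

theorem measurableSet_pathProd_mem (A : Set Γ) (n : ℕ) :
    MeasurableSet {x : ℕ → Γ | pathProd x n ∈ A} :=
  measurable_pathProd n (.of_discrete (s := A))

theorem measurableSet_pathProd_mem_and_shift (A : Set Γ) (n : ℕ) {B : Set (ℕ → Γ)}
    (hB : MeasurableSet B) : MeasurableSet {x : ℕ → Γ | pathProd x n ∈ A ∧ shift n x ∈ B} := by
  rw [Set.ofPred_and]
  exact (measurableSet_pathProd_mem A n).inter (measurable_shift n hB)

theorem measurableSet_noReturn (φ : Γ →* H) : MeasurableSet (noReturn φ) := by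
  simp only [noReturn, Set.ofPred_forall]
  exact .iInter fun n => .iInter fun _ => measurableSet_pathProd_mem {g | φ g ≠ 1} n

/-- The events that the last visit to `h` occurs at time `k` are disjoint for distinct `k`, and each
of them is the intersection of a visit at time `k` with an independent event of probability
`pathLaw m (noReturn φ)`. -/
theorem tsum_visit_mul_noReturn_le (φ : Γ →* H) (h : H) :
    (∑' k : ℕ, pathLaw m {x | φ (pathProd x k) = h}) * pathLaw m (noReturn φ) ≤ 1 := by
  have hmeas := measurableSet_noReturn (Γ := Γ) φ
  rw [← ENNReal.tsum_mul_right]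
  calc ∑' k : ℕ, pathLaw m {x | φ (pathProd x k) = h} * pathLaw m (noReturn φ)
      = ∑' k : ℕ, pathLaw m {x | pathProd x k ∈ {g | φ g = h} ∧ shift k x ∈ noReturn φ} :=
        tsum_congr fun k => (pathLaw_inter_shift m k {g | φ g = h} hmeas).symm
    _ = pathLaw m (⋃ k, {x | pathProd x k ∈ {g | φ g = h} ∧ shift k x ∈ noReturn φ}) := by
        refine (measure_iUnion (fun j k hjk => ?_) fun k => ?_).symm
        · have hlt : ∀ a c, a < c → Disjoint
              {x : ℕ → Γ | pathProd x a ∈ {g | φ g = h} ∧ shift a x ∈ noReturn φ}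
              {x : ℕ → Γ | pathProd x c ∈ {g | φ g = h} ∧ shift c x ∈ noReturn φ} := by
            intro a c hac
            refine Set.disjoint_left.2 fun x ⟨ha, ha'⟩ ⟨hc, _⟩ => ha' (c - a) (by omega) ?_
            have hprod := pathProd_add x a (c - a)
            rw [Nat.add_sub_cancel' hac.le] at hprod
            have hc' : φ (pathProd x c) = h := hc
            have ha2 : φ (pathProd x a) = h := ha
            rw [hprod, map_mul, ha2] at hc'
            exact mul_eq_left.1 hc'
          rcases lt_or_gt_of_ne hjk with hl | hl
          exacts [hlt j k hl, (hlt k j hl).symm]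
        · exact measurableSet_pathProd_mem_and_shift _ k hmeas
    _ ≤ 1 := prob_le_one

/-- A transient walk leaves every finite set for good. -/
theorem ae_eventually_notMem_finite {φ : Γ →* H} (htrans : pathLaw m (noReturn φ) ≠ 0) {A : Set H}
    (hA : A.Finite) : ∀ᵐ x ∂pathLaw m, ∀ᶠ n in atTop, φ (pathProd x n) ∉ A := by
  have h : ∀ a ∈ A, ∀ᵐ x ∂pathLaw m, ∀ᶠ n in atTop, φ (pathProd x n) ≠ a := fun a _ => by
    refine ae_eventually_notMem (s := fun n => {x : ℕ → Γ | φ (pathProd x n) = a}) fun htop => ?_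
    have := tsum_visit_mul_noReturn_le m φ a
    rw [htop, ENNReal.top_mul htrans] at this
    simp at this
  filter_upwards [(ae_ball_iff hA.countable).2 h] with x hx
  filter_upwards [(eventually_all_finite hA).2 hx] with n hn hmem
  exact hn _ hmem rfl

/-- If the support of the step distribution generates the group as a semigroup, the walk visits
every element with positive probability. -/
theorem exists_pathLaw_eq_ne_zero (hgen : Submonoid.closure {g | m {g} ≠ 0} = ⊤) (g : Γ) :
    ∃ k, pathLaw m {x | pathProd x k ∈ ({g} : Set Γ)} ≠ 0 := by
  have hg : g ∈ Submonoid.closure {g | m {g} ≠ 0} := hgen ▸ Submonoid.mem_top g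
  induction hg using Submonoid.closure_induction with
  | mem g hg =>
    refine ⟨1, ?_⟩
    simp only [pathProd_one]
    have h := (measurePreserving_eval_infinitePi (fun _ : ℕ => m) 0).measure_preimage
      (MeasurableSet.of_discrete (s := {g})).nullMeasurableSet
    exact h.trans_ne hg
  | one => exact ⟨0, by simp⟩
  | mul g h _ _ ihg ihh =>
    obtain ⟨j, hj⟩ := ihg
    obtain ⟨k, hk⟩ := ihh
    refine ⟨j + k, fun h0 => mul_ne_zero hj hk ?_⟩
    rw [← pathLaw_inter_shift m j {g} (measurableSet_pathProd_mem {h} k)]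
    refine measure_mono_null ?_ h0
    rintro x ⟨h1, h2⟩
    rw [Set.mem_singleton_iff] at h1
    have h2' : pathProd (shift j x) k = h := h2
    exact (pathProd_add x j k).trans (by rw [h1, h2'])

end Transience

/-! ### Linear growth of the number of lit lamps -/

namespace Lamplighter

variable {G : Type*} [Group G]

theorem zmod_two_eq_zero_or_eq_one (a : ZMod 2) : a = 0 ∨ a = 1 := by revert a; decide

/-- The paths that from time `M` on stay away from the identity and keep the lamp there in the
state `a`. -/
def settledSet (G : Type*) [Group G] (a : ZMod 2) (M : ℕ) : Set (ℕ → Lamplighter G) :=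
  {x | ∀ n : ℕ, M ≤ n → (pathProd x n).lamps 1 = a ∧ (pathProd x n).pos ≠ 1}

theorem settledSet_mono (a : ZMod 2) {M N : ℕ} (h : M ≤ N) :
    settledSet G a M ⊆ settledSet G a N := fun _ hx n hn => hx n (h.trans hn)

/-- The paths that at time `k` are at a place to which they do not return from time `k + M` on, and
whose lamp is lit from then on. -/
def litSet (G : Type*) [Group G] (M k : ℕ) : Set (ℕ → Lamplighter G) :=
  {x | shift k x ∈ settledSet G (1 + (pathProd x k).lamps (pathProd x k).pos) M}

theorem litSet_spec {M k n : ℕ} {x : ℕ → Lamplighter G} (hx : x ∈ litSet G M k)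
    (hn : k + M ≤ n) :
    (pathProd x n).lamps (pathProd x k).pos = 1 ∧ (pathProd x n).pos ≠ (pathProd x k).pos := by
  obtain ⟨r, rfl⟩ := Nat.exists_eq_add_of_le (show k ≤ n by omega)
  obtain ⟨h1, h2⟩ := hx r (by omega)
  rw [pathProd_add]
  refine ⟨?_, by simpa using h2⟩
  simp only [mul_lamps, Finsupp.add_apply, translate_apply, inv_mul_cancel, h1]
  rcases zmod_two_eq_zero_or_eq_one ((pathProd x k).lamps (pathProd x k).pos) with h | h <;>
    rw [h] <;> decide

open Classical in
/-- The times `q * M` at which the path lies in `litSet` have distinct positions, all of them places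
of lit lamps at time `n`. -/
theorem card_litSet_le (M n : ℕ) (x : ℕ → Lamplighter G) :
    ((Finset.range (n / M)).filter fun q => x ∈ litSet G M (q * M)).card ≤
      (pathProd x n).lamps.support.card := by
  refine Finset.card_le_card_of_injOn (fun q => (pathProd x (q * M)).pos) ?_ ?_
  · intro q hq
    simp only [Finset.coe_filter, Finset.mem_range, Set.mem_ofPred_eq] at hq
    have hqn : q * M + M ≤ n := by
      calc q * M + M = (q + 1) * M := by ring
        _ ≤ n / M * M := Nat.mul_le_mul_right _ hq.1
        _ ≤ n := Nat.div_mul_le_self _ _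
    simp [(litSet_spec hq.2 hqn).1]
  · have hlt : ∀ q r, q < r → x ∈ litSet G M (q * M) →
        (pathProd x (r * M)).pos ≠ (pathProd x (q * M)).pos := by
      intro q r hqr hq
      refine (litSet_spec hq ?_).2
      calc q * M + M = (q + 1) * M := by ring
        _ ≤ r * M := Nat.mul_le_mul_right _ hqr
    intro q hq r hr hqr
    simp only [Finset.coe_filter, Finset.mem_range, Set.mem_ofPred_eq] at hq hr
    rcases lt_trichotomy q r with h | h | h
    exacts [(hlt q r h hq.2 hqr.symm).elim, h, (hlt r q h hr.2 hqr).elim]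

theorem litSet_eq_union (M k : ℕ) : litSet G M k =
    {x | pathProd x k ∈ {g : Lamplighter G | g.lamps g.pos = 0} ∧ shift k x ∈ settledSet G 1 M} ∪
    {x | pathProd x k ∈ {g : Lamplighter G | g.lamps g.pos = 0}ᶜ ∧
      shift k x ∈ settledSet G 0 M} := by
  ext x
  rcases zmod_two_eq_zero_or_eq_one ((pathProd x k).lamps (pathProd x k).pos) with h | h
  · simp [litSet, h]
  · simp [litSet, h, show (1 : ZMod 2) + 1 = 0 from by decide]

variable [Countable G]

theorem measurableSet_settledSet (a : ZMod 2) (M : ℕ) : MeasurableSet (settledSet G a M) := by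
  simp only [settledSet, Set.ofPred_forall]
  exact .iInter fun n => .iInter fun _ =>
    measurableSet_pathProd_mem {g : Lamplighter G | g.lamps 1 = a ∧ g.pos ≠ 1} n

variable (m : Measure (Lamplighter G)) [IsProbabilityMeasure m]

theorem ae_exists_mem_settledSet {B : Set G} (hB : B.Finite)
    (hrange : ∀ᵐ g ∂m, ↑g.lamps.support ⊆ B) (htrans : pathLaw m (noReturn posHom) ≠ 0) :
    ∀ᵐ x ∂pathLaw m, ∃ a M, x ∈ settledSet G a M := by
  have hsteps : ∀ᵐ x ∂pathLaw m, ∀ k, ↑(x k).lamps.support ⊆ B := ae_all_iff.2 fun k =>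
    (measurePreserving_eval_infinitePi (fun _ : ℕ => m) k).quasiMeasurePreserving.ae hrange
  filter_upwards [hsteps, ae_eventually_notMem_finite m htrans (A := insert 1 B⁻¹)
    (hB.inv.insert 1)] with x hx hesc
  obtain ⟨M, hM⟩ := eventually_atTop.1 hesc
  refine ⟨(pathProd x M).lamps 1, M, fun n hn => ⟨?_, fun h1 => hM n hn (Or.inl h1)⟩⟩
  induction n, hn using Nat.le_induction with
  | base => rfl
  | succ n hn ih =>
    rw [pathProd_succ, mul_lamps, Finsupp.add_apply, translate_apply, ih, mul_one, add_eq_left]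
    by_contra h
    refine hM n hn (Or.inr ?_)
    exact hx n (Finsupp.mem_support_iff.2 h)

/-- With positive probability the lamp at the identity settles in either state: it settles in some
state, and switching it first, which an irreducible walk does with positive probability, gives the
other one. -/
theorem exists_settledSet_ne_zero {B : Set G} (hB : B.Finite)
    (hrange : ∀ᵐ g ∂m, ↑g.lamps.support ⊆ B) (htrans : pathLaw m (noReturn posHom) ≠ 0)
    (hgen : Submonoid.closure {g | m {g} ≠ 0} = ⊤) :
    ∃ M, 0 < M ∧ ∀ a, pathLaw m (settledSet G a M) ≠ 0 := by
  obtain ⟨a, M, haM⟩ : ∃ a M, pathLaw m (settledSet G a M) ≠ 0 := by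
    by_contra! h
    have hae := ae_exists_mem_settledSet m hB hrange htrans
    have h0 : ∀ᵐ x ∂pathLaw m, ∀ a M, x ∉ settledSet G a M :=
      ae_all_iff.2 fun a => ae_all_iff.2 fun M => measure_eq_zero_iff_ae_notMem.1 (h a M)
    obtain ⟨x, ⟨a, M, hx⟩, hx'⟩ := (hae.and h0).exists
    exact hx' a M hx
  obtain ⟨k, hk⟩ := exists_pathLaw_eq_ne_zero m hgen switch
  have hflip : pathLaw m (settledSet G (1 + a) (k + M)) ≠ 0 := by
    refine fun h0 => mul_ne_zero hk haM ?_
    rw [← pathLaw_inter_shift m k {switch} (measurableSet_settledSet a M)]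
    refine measure_mono_null ?_ h0
    rintro x ⟨h1, h2⟩ n hn
    obtain ⟨r, rfl⟩ := Nat.exists_eq_add_of_le (show k ≤ n by omega)
    obtain ⟨h3, h4⟩ := h2 r (by omega)
    rw [pathProd_add, Set.mem_singleton_iff.1 h1]
    simp [switch, h3, h4]
  refine ⟨k + M + 1, by omega, fun b => ?_⟩
  have hb : b = a ∨ b = 1 + a := by
    rcases zmod_two_eq_zero_or_eq_one a with rfl | rfl <;>
      rcases zmod_two_eq_zero_or_eq_one b with rfl | rfl <;> decide
  rcases hb with rfl | rfl
  · exact fun h => haM (measure_mono_null (settledSet_mono _ (by omega)) h)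
  · exact fun h => hflip (measure_mono_null (settledSet_mono _ (by omega)) h)

theorem measurableSet_litSet (M k : ℕ) : MeasurableSet (litSet G M k) := by
  rw [litSet_eq_union]
  exact (measurableSet_pathProd_mem_and_shift _ k (measurableSet_settledSet 1 M)).union
    (measurableSet_pathProd_mem_and_shift _ k (measurableSet_settledSet 0 M))

theorem le_pathLaw_litSet (M k : ℕ) :
    min (pathLaw m (settledSet G 0 M)) (pathLaw m (settledSet G 1 M)) ≤
      pathLaw m (litSet G M k) := by
  set p := min (pathLaw m (settledSet G 0 M)) (pathLaw m (settledSet G 1 M))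
  set A : Set (Lamplighter G) := {g | g.lamps g.pos = 0}
  have hone : pathLaw m {x | pathProd x k ∈ A} + pathLaw m {x | pathProd x k ∈ Aᶜ} = 1 :=
    prob_add_prob_compl (measurableSet_pathProd_mem A k)
  have hdisj : Disjoint
      {x : ℕ → Lamplighter G | pathProd x k ∈ A ∧ shift k x ∈ settledSet G 1 M}
      {x | pathProd x k ∈ Aᶜ ∧ shift k x ∈ settledSet G 0 M} :=
    Set.disjoint_left.2 fun x h1 h2 => h2.1 h1.1
  rw [litSet_eq_union, measure_union hdisj
    (measurableSet_pathProd_mem_and_shift _ k (measurableSet_settledSet 0 M)),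
    pathLaw_inter_shift m k A (measurableSet_settledSet 1 M),
    pathLaw_inter_shift m k Aᶜ (measurableSet_settledSet 0 M)]
  calc p = (pathLaw m {x | pathProd x k ∈ A} + pathLaw m {x | pathProd x k ∈ Aᶜ}) * p := by
        rw [hone, one_mul]
    _ ≤ _ := by
        rw [add_mul]
        gcongr
        exacts [min_le_right _ _, min_le_left _ _]

/-- The speed at which lamps are lit is positive, provided the walk is transient. -/
theorem pos_of_tendsto_integral_card {B : Set G} (hB : B.Finite)
    (hrange : ∀ᵐ g ∂m, ↑g.lamps.support ⊆ B) (htrans : pathLaw m (noReturn posHom) ≠ 0)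
    (hgen : Submonoid.closure {g | m {g} ≠ 0} = ⊤)
    (hint : ∀ n, Integrable (fun x => ((pathProd x n).lamps.support.card : ℝ)) (pathLaw m)) {γ : ℝ}
    (hγ : Tendsto (fun n : ℕ => (∫ x, ((pathProd x n).lamps.support.card : ℝ) ∂pathLaw m) / n)
      atTop (𝓝 γ)) : 0 < γ := by
  classical
  obtain ⟨M, hM, hset⟩ := exists_settledSet_ne_zero m hB hrange htrans hgen
  set p := min (pathLaw m (settledSet G 0 M)) (pathLaw m (settledSet G 1 M)) with hp
  have hp0 : 0 < p.toReal := ENNReal.toReal_pos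
    (lt_min (pos_iff_ne_zero.2 (hset 0)) (pos_iff_ne_zero.2 (hset 1))).ne'
    ((min_le_left _ _).trans_lt (measure_lt_top _ _)).ne
  have hlower : ∀ n : ℕ, (n / M : ℕ) * p.toReal ≤
      ∫ x, ((pathProd x n).lamps.support.card : ℝ) ∂pathLaw m := by
    intro n
    have hind : ∀ q, Integrable ((litSet G M (q * M)).indicator fun _ => (1 : ℝ)) (pathLaw m) :=
      fun q => (integrable_const 1).indicator (measurableSet_litSet M _)
    calc (n / M : ℕ) * p.toReal
        = ∑ q ∈ Finset.range (n / M), p.toReal := by simp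
      _ ≤ ∑ q ∈ Finset.range (n / M), (pathLaw m).real (litSet G M (q * M)) :=
          Finset.sum_le_sum fun q _ =>
            ENNReal.toReal_mono (measure_ne_top _ _) (le_pathLaw_litSet m M _)
      _ = ∫ x, ∑ q ∈ Finset.range (n / M),
            (litSet G M (q * M)).indicator (fun _ => (1 : ℝ)) x ∂pathLaw m := by
          rw [integral_finsetSum _ fun q _ => hind q]
          refine Finset.sum_congr rfl fun q _ => ?_
          rw [integral_indicator_const _ (measurableSet_litSet M _), smul_eq_mul, mul_one]
      _ ≤ _ := by
          refine integral_mono (integrable_finsetSum _ fun q _ => hind q) (hint n) fun x => ?_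
          have h : ∑ q ∈ Finset.range (n / M),
              (litSet G M (q * M)).indicator (fun _ => (1 : ℝ)) x =
              ((Finset.range (n / M)).filter fun q => x ∈ litSet G M (q * M)).card := by
            rw [Finset.card_filter]
            push_cast
            exact Finset.sum_congr rfl fun q _ => by rw [Set.indicator_apply]
          simp only [h]
          exact_mod_cast card_litSet_le M n x
  have hle : 1 / (M : ℝ) * p.toReal ≤ γ := by
    refine le_of_tendsto_of_tendsto' ((tendsto_natDiv_div_atTop M).mul_const p.toReal) hγ
      fun n => ?_
    rw [div_mul_eq_mul_div]
    gcongr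
    exact hlower n
  have : (0 : ℝ) < M := by exact_mod_cast hM
  exact lt_of_lt_of_le (by positivity) hle

end Lamplighter

/-! ### Integrability of the increments -/

section Integrability

variable {α : Type*} [MeasurableSpace α] [DiscreteMeasurableSpace α]

theorem PMF.ae_toMeasure_pos (μ : PMF α) : ∀ᵐ a ∂μ.toMeasure, 0 < μ a := by
  rw [ae_iff, PMF.toMeasure_apply_eq_zero_iff μ .of_discrete]
  exact Set.disjoint_left.2 fun a ha h => h (pos_iff_ne_zero.2 ha)

theorem PMF.integrable_of_summable [Countable α] (μ : PMF α) {f : α → ℝ}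
    (h0 : ∀ a, 0 ≤ f a) (h : Summable fun a => f a * (μ a).toReal) : Integrable f μ.toMeasure := by
  refine ⟨(measurable_of_countable f).aestronglyMeasurable, ?_⟩
  rw [hasFiniteIntegral_iff_ofReal (ae_of_all _ h0), lintegral_countable']
  have hterm : ∀ a, ENNReal.ofReal (f a) * μ.toMeasure {a} =
      ENNReal.ofReal (f a * (μ a).toReal) := fun a => by
    rw [ENNReal.ofReal_mul (h0 a), ENNReal.ofReal_toReal (μ.apply_ne_top a),
      PMF.toMeasure_apply_singleton μ a (measurableSet_singleton a)]
  simp_rw [hterm]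
  exact h.tsum_ofReal_lt_top

end Integrability

/-! ### The speeds of the lamplighter walk -/

theorem theorem3p3 {G : Type*} [Group G] [Infinite G]
    -- a finite symmetric generating set with positive symmetric lengths, and the lamp cost `c`
    (S : Set G) (hSfin : S.Finite) (hS1 : (1 : G) ∉ S) (hSsymm : ∀ s ∈ S, s⁻¹ ∈ S)
    (hSgen : Submonoid.closure S = ⊤)
    (l : G → ℝ) (hlpos : ∀ s ∈ S, 0 < l s) (hlsymm : ∀ s ∈ S, l s⁻¹ = l s)
    (c : ℝ) (hc : 0 ≤ c)
    -- the step distribution: irreducible, bounded switching range, finite first moment on `G`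
    (μ : PMF (Lamplighter G)) (hμgen : Submonoid.closure μ.support = ⊤)
    (R : ℝ) (hR : 0 ≤ R)
    (hμrange : ∀ g : Lamplighter G, 0 < μ g → ∀ y ∈ g.lamps.support, wordDist S l 1 y ≤ R)
    (hμmoment : Summable fun g : Lamplighter G => wordDist S l 1 g.pos * (μ g).toReal)
    -- i.i.d. increments with law `μ`
    {Ω : Type*} [MeasurableSpace Ω] (P : Measure Ω) [IsProbabilityMeasure P]
    (i : ℕ → Ω → Lamplighter G) (hi_meas : ∀ n, Measurable (i n))
    (hi_indep : iIndepFun i P) (hi_law : ∀ n, P.map (i n) = μ.toMeasure)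
    -- the projection onto `G` is transient
    (htrans : TransientWalk P fun n ω => (randomWalk i n ω).pos) :
    ∃ ℓ₀ ℓ ℓsupp : ℝ,
      (∀ᵐ ω ∂P, Tendsto (fun n : ℕ => wordDist S l 1 (randomWalk i n ω).pos / n)
        atTop (𝓝 ℓ₀)) ∧
      (∀ᵐ ω ∂P, Tendsto (fun n : ℕ => Lamplighter.length S l c (randomWalk i n ω) / n)
        atTop (𝓝 ℓ)) ∧
      (∀ᵐ ω ∂P, Tendsto (fun n : ℕ => ((randomWalk i n ω).lamps.support.card : ℝ) / n)
        atTop (𝓝 ℓsupp)) ∧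
      0 < ℓsupp ∧
      (0 < c → ℓ₀ < ℓ) := by
  have : Countable G := countable_of_closure_eq_top hSfin.countable hSgen
  have hl : ∀ s ∈ S, 0 ≤ l s := fun s hs => (hlpos s hs).le
  set m := μ.toMeasure
  have hpath : Measurable fun ω k => i k ω := measurable_pi_iff.2 hi_meas
  have hlaw : P.map (fun ω k => i k ω) = pathLaw m := by
    rw [hi_indep.map_fun_eq_infinitePi_map hi_meas]
    simp_rw [hi_law]
  -- `B` is a finite ball that contains the lamps switched by almost every increment.
  have hB := finite_wordDist_le hSfin hSgen hlpos R
  set B := {y | wordDist S l 1 y ≤ R}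
  have hrange : ∀ᵐ g ∂m, ↑g.lamps.support ⊆ B :=
    μ.ae_toMeasure_pos.mono fun g hg y hy => hμrange g hg y hy
  have hgen : Submonoid.closure {g | m {g} ≠ 0} = ⊤ := by
    rw [← hμgen]
    congr 1
    ext g
    simp [m, PMF.toMeasure_apply_singleton μ g (measurableSet_singleton g)]
  have hret : pathLaw m (noReturn Lamplighter.posHom) ≠ 0 := by
    intro h0
    rw [← hlaw, Measure.map_apply hpath (measurableSet_noReturn _)] at h0
    have hsub : (Set.univ : Set Ω) ⊆
        {ω | ∃ n : ℕ, 1 ≤ n ∧ (randomWalk i n ω).pos = 1} ∪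
          (fun ω k => i k ω) ⁻¹' noReturn Lamplighter.posHom := by
      intro ω _
      by_cases h : ∃ n : ℕ, 1 ≤ n ∧ (randomWalk i n ω).pos = 1
      · exact Or.inl h
      · refine Or.inr fun n hn h1 => h ⟨n, hn, ?_⟩
        rw [randomWalk_eq_pathProd]
        exact h1
    have hle := (measure_mono (μ := P) hsub).trans (measure_union_le _ _)
    rw [h0, add_zero, measure_univ] at hle
    exact htrans.not_ge hle
  -- The distance of the position, the number of lit lamps and the length are all integrable: the
  -- second is bounded, and the third exceeds the first by at most the cost of lighting all of `B`.
  have hint0 : Integrable (fun g : Lamplighter G => wordDist S l 1 g.pos) m :=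
    μ.integrable_of_summable (fun g => wordDist_nonneg hl _ _) hμmoment
  have hints : Integrable (fun g : Lamplighter G => (g.lamps.support.card : ℝ)) m := by
    refine (integrable_const (hB.toFinset.card : ℝ)).mono'
      (measurable_of_countable _).aestronglyMeasurable (hrange.mono fun g hg => ?_)
    rw [Real.norm_of_nonneg (Nat.cast_nonneg _)]
    exact_mod_cast Finset.card_le_card fun y hy => hB.mem_toFinset.2 (hg hy)
  have hintl : Integrable (Lamplighter.length S l c) m := by
    refine ((integrable_const (∑ y ∈ hB.toFinset,
      Lamplighter.length S l c (Lamplighter.lampAt y))).add hint0).mono'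
      (measurable_of_countable _).aestronglyMeasurable (hrange.mono fun g hg => ?_)
    rw [Real.norm_of_nonneg (Lamplighter.length_nonneg hl hc g)]
    refine (Lamplighter.length_le_sum_add hSgen hl hc g).trans (add_le_add ?_ le_rfl)
    exact Finset.sum_le_sum_of_subset_of_nonneg (fun y hy => hB.mem_toFinset.2 (hg hy))
      fun y _ _ => Lamplighter.length_nonneg hl hc _
  have hs0 : ∀ g : Lamplighter G, (0 : ℝ) ≤ g.lamps.support.card := fun g => Nat.cast_nonneg _
  have hs1 : (((1 : Lamplighter G).lamps.support.card : ℕ) : ℝ) = 0 := by simp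
  have hsmul : ∀ g h : Lamplighter G, ((g * h).lamps.support.card : ℝ) ≤
      g.lamps.support.card + h.lamps.support.card := fun g h => by
    exact_mod_cast Lamplighter.card_support_mul_le g h
  obtain ⟨ℓ₀, hℓ₀, -⟩ := exists_tendsto_apply_pathProd_div (m := m)
    (f := fun g : Lamplighter G => wordDist S l 1 g.pos) (fun g => wordDist_nonneg hl _ _)
    (wordDist_one_one hl) (fun g h => wordDist_mul_le hSgen hl g.pos h.pos) hint0
  obtain ⟨ℓ, hℓ, -⟩ := exists_tendsto_apply_pathProd_div (Lamplighter.length_nonneg hl hc)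
    (Lamplighter.length_one hl hc) (Lamplighter.length_mul_le hSgen hl hc) hintl
  obtain ⟨ℓs, hℓs, hmean⟩ := exists_tendsto_apply_pathProd_div hs0 hs1 hsmul hints
  have hspos : 0 < ℓs := Lamplighter.pos_of_tendsto_integral_card m hB hrange hret hgen
    (integrable_apply_pathProd hs0 hs1 hsmul hints) hmean
  simp_rw [randomWalk_eq_pathProd]
  refine ⟨ℓ₀, ℓ, ℓs, ae_of_ae_map hpath.aemeasurable (hlaw ▸ hℓ₀),
    ae_of_ae_map hpath.aemeasurable (hlaw ▸ hℓ), ae_of_ae_map hpath.aemeasurable (hlaw ▸ hℓs),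
    hspos, fun hcpos => ?_⟩
  -- The length is at least the distance plus `c` times the number of lit lamps, so `ℓ ≥ ℓ₀ + c ℓs`.
  obtain ⟨x, ⟨hx₀, hx⟩, hxs⟩ := ((hℓ₀.and hℓ).and hℓs).exists
  refine lt_of_lt_of_le (lt_add_of_pos_right ℓ₀ (mul_pos hcpos hspos)) ?_
  refine le_of_tendsto_of_tendsto' (hx₀.add (hxs.const_mul c)) hx fun n => ?_
  rw [← mul_div_assoc, ← add_div]
  gcongr
  exact Lamplighter.wordDist_add_le_length hSgen hl hc _
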